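/- For $n\ge 1$ let $I$ be the $n\times n$ identity matrix, let $T$ be the $n\times n$ integer matrix of the left shift $(x_0,x_1,\ldots,x_{n-1})\mapsto(x_1,\ldots,x_{n-1},x_0)$, that is, $T=\mathrm{circ}(0,1,0,\ldots,0)$ (so that $T=I$ for $n=1$), and let $A=4I-T-T^{-1}$. For an integer $n\times n$ matrix $M$ put $\operatorname{coker}M=\mathbb{Z}^n/\operatorname{im}M$. Let $$\nu(n)=\begin{cases}\sqrt7\,U_{\frac n2-1}\left(\tfrac52\right) & \text{if } n \text{ is odd},\\ U_{\frac n2-1}\left(\tfrac52\right) & \text{if } n \text{ is even},\end{cases}$$ where $U_{m-1}(x)=\frac{\sin(m\arccos x)}{\sin(\arccos x)}$ is the Chebyshev function of the second kind (with the principal branch of the complex arc cosine; $m$ may be a half-integer). Let $\mu(n)=1$ if $n$ is odd and $\mu(n)=7$ if $n$ is even, and let $\widehat\mu(n)=\gcd(n,3)\,\mu(n)$. Then $\nu(n)$ is a nonnegative integer, $\gcd(n,3)$ divides $\gcd(n,\nu(n))$, and there is an isomorphism of abelian groups $$\operatorname{coker}\big((-2I+A)(I+A)\big)\cong\mathbb{Z}_{\frac{\gcd(n,\nu(n))}{\gcd(n,3)}}\oplus\mathbb{Z}_{\nu(n)}\oplus\mathbb{Z}_{\frac{n\,\widehat\mu(n)\,\nu(n)}{\gcd(n,\nu(n))}}\oplus\mathbb{Z}.$$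 -/

import Mathlib

/-- The principal branch of the complex arc cosine, `arccos z = -i log (z + i √(1 - z²))`. -/
noncomputable def complexArccos (z : ℂ) : ℂ :=
  -Complex.I * Complex.log (z + Complex.I * (1 - z ^ 2) ^ (1 / 2 : ℂ))

theorem cos_complexArccos (z : ℂ) : Complex.cos (complexArccos z) = z := by
  unfold complexArccos
  set s : ℂ := (1 - z ^ 2) ^ (1 / 2 : ℂ) with hs
  have hsq : s ^ 2 = 1 - z ^ 2 := by
    rw [hs, ← Complex.cpow_nat_mul]
    norm_num
  have hmul : (z + Complex.I * s) * (z - Complex.I * s) = 1 := by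
    linear_combination hsq - s ^ 2 * Complex.I_sq
  have hne : z + Complex.I * s ≠ 0 := left_ne_zero_of_mul_eq_one hmul
  have hinv : (z + Complex.I * s)⁻¹ = z - Complex.I * s :=
    inv_eq_of_mul_eq_one_right hmul
  have h1 : -Complex.I * Complex.log (z + Complex.I * s) * Complex.I
      = Complex.log (z + Complex.I * s) := by
    linear_combination -Complex.log (z + Complex.I * s) * Complex.I_sq
  rw [Complex.cos, neg_mul (-Complex.I * Complex.log _), h1, Complex.exp_neg, Complex.exp_log hne, hinv]
  ring

/-- The Chebyshev function of the second kind `U_s(x)` for an arbitrary (for example half-integer)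
index `s`, normalised as `U_{m-1}(x) = sin (m arccos x) / sin (arccos x)`. -/
noncomputable def chebyshevU (s x : ℂ) : ℂ :=
  Complex.sin ((s + 1) * complexArccos x) / Complex.sin (complexArccos x)

/-- `ν(n) = √7 U_{n/2-1}(5/2)` for odd `n` and `ν(n) = U_{n/2-1}(5/2)` for even `n`
(the index `n/2 - 1` is a genuine half-integer when `n` is odd). -/
noncomputable def nu (n : ℕ) : ℂ :=
  if Odd n then (Real.sqrt 7 : ℂ) * chebyshevU ((n : ℂ) / 2 - 1) (5 / 2)
  else chebyshevU ((n : ℂ) / 2 - 1) (5 / 2)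

/-- The 2-periodic sequence `μ(1), μ(2), μ(3), … = 1, 7, 1, …`. -/
def mu (n : ℕ) : ℕ := if Odd n then 1 else 7

/-- `μ̂(n) = gcd(n, 3) μ(n)`. -/
def muHat (n : ℕ) : ℕ := Nat.gcd n 3 * mu n

/-- The matrix of the left shift `(x₀, x₁, …, xₙ₋₁) ↦ (x₁, …, xₙ₋₁, x₀)`,
that is, `circ(0, 1, 0, …, 0)`. -/
def shiftMatrix (n : ℕ) : Matrix (Fin n) (Fin n) ℤ :=
  Matrix.of fun i j => if (j : ℕ) = ((i : ℕ) + 1) % n then 1 else 0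

/-- `A = 4I - T - T⁻¹`. -/
noncomputable def matrixA (n : ℕ) : Matrix (Fin n) (Fin n) ℤ :=
  (4 : ℤ) • (1 : Matrix (Fin n) (Fin n) ℤ) - shiftMatrix n - (shiftMatrix n)⁻¹

/-- The cokernel `ℤⁿ / im M` of an integer `n × n` matrix. -/
abbrev coker {n : ℕ} (M : Matrix (Fin n) (Fin n) ℤ) : Type :=
  (Fin n → ℤ) ⧸ LinearMap.range M.mulVecLin

/-! Since `T ^ n = 1`, the cokernel is a quotient of `ℤ[X]/(X^n - 1)`. There `X` is a unit, and
clearing `X⁻¹` turns the operator into `(X - 1) * cubic` (`exists_dvd_sub_iff`). Both `X^n - 1` and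
`(X - 1) * cubic` vanish at `1`, so evaluation at `1` splits off `ℤ`. What remains is `R/(S)`, with
`R = ℤ[X]/(cubic)` and `S = 1 + ξ + … + ξ^(n-1)` (`exists_hom_polynomial`).

Put `E = ξ² - 5ξ + 1`. As `(ξ - 1) E = 0`, `ξ` acts as `1` on `ℤE`, and modulo `E` one has `ξ + ξ⁻¹
= 5`, the Chebyshev recurrence. Hence, up to a unit, `S` is `v + cE` for odd `n` and `v(1 + ξ) + cE`
for even `n`, where `v = ν(n)`. Setting `ξ = 1` gives `n = v - 3c`, respectively `n = 2v - 3c`.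

In suitable coordinates the ideal `(S)` is `vℤ` plus a triangular rank-two lattice, whose Smith form
has first invariant `gcd(v, c)` (`exists_hom_odd`, `exists_hom_even`). A 3-adic comparison of `v`
with `n` (`gcd_mul_gcd_three`) identifies this with `gcd(n, v) / gcd(n, 3)`; for even `n`, a 7-adic
one (`dvd_chebSeq_of_dvd`) is needed too. -/

/-! ### The integer sequence behind `ν(n)`. -/

/-- The sequence `U_{k-1}(5/2)`: `0, 1, 5, 24, …`. -/
def chebSeq : ℕ → ℤ
  | 0 => 0
  | 1 => 1
  | k + 2 => 5 * chebSeq (k + 1) - chebSeq k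

theorem chebSeq_add_two (k : ℕ) : chebSeq (k + 2) = 5 * chebSeq (k + 1) - chebSeq k := rfl

theorem chebSeq_lt_succ (k : ℕ) : 0 ≤ chebSeq k ∧ chebSeq k < chebSeq (k + 1) := by
  induction k with
  | zero => simp [chebSeq]
  | succ k ih => rw [chebSeq_add_two]; omega

theorem chebSeq_nonneg (k : ℕ) : 0 ≤ chebSeq k := (chebSeq_lt_succ k).1

theorem chebSeq_pos {k : ℕ} (hk : 0 < k) : 0 < chebSeq k := by
  obtain ⟨k, rfl⟩ := Nat.exists_eq_add_one.2 hk
  exact (chebSeq_nonneg k).trans_lt (chebSeq_lt_succ k).2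

/-- Modulo 3 the recurrence is `x_{k+2} = 2 x_{k+1} - x_k`, whose solutions are arithmetic
progressions. -/
theorem chebSeq_modEq_three (k : ℕ) :
    chebSeq k ≡ k [ZMOD 3] ∧ chebSeq (k + 1) ≡ k + 1 [ZMOD 3] := by
  induction k with
  | zero => simp [chebSeq, Int.ModEq]
  | succ k ih =>
    refine ⟨by exact_mod_cast ih.2, ?_⟩
    rw [chebSeq_add_two]
    have h1 := ih.1
    have h2 := ih.2
    simp only [Int.ModEq] at *
    push_cast
    omega

theorem sin_recurrence {θ : ℂ} (hθ : Complex.cos θ = 5 / 2) (z : ℂ) :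
    Complex.sin (z + 2 * θ) = 5 * Complex.sin (z + θ) - Complex.sin z := by
  have h1 : Complex.sin (z + 2 * θ) = Complex.sin ((z + θ) + θ) := by ring_nf
  have h2 : Complex.sin z = Complex.sin ((z + θ) - θ) := by ring_nf
  rw [h1, h2, Complex.sin_add (z + θ), Complex.sin_sub (z + θ), hθ]
  ring

theorem sin_nat_mul {θ : ℂ} (hθ : Complex.cos θ = 5 / 2) (k : ℕ) :
    Complex.sin (k * θ) = chebSeq k * Complex.sin θ ∧
      Complex.sin ((k + 1 : ℕ) * θ) = chebSeq (k + 1) * Complex.sin θ := by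
  induction k with
  | zero => simp [chebSeq]
  | succ k ih =>
    refine ⟨ih.2, ?_⟩
    have := sin_recurrence hθ (k * θ)
    rw [chebSeq_add_two]
    push_cast at ih ⊢
    have h1 : ((k : ℂ) + 1 + 1) * θ = k * θ + 2 * θ := by ring
    have h2 : (k : ℂ) * θ + θ = (k + 1) * θ := by ring
    rw [h1, this, h2, ih.1, ih.2]
    ring

/-- Advancing by `θ = 2ψ` from odd multiples of `ψ` keeps the same recurrence; this covers the
half-integer indices. -/
theorem sin_odd_mul {ψ : ℂ} (hψ : Complex.cos (2 * ψ) = 5 / 2) (k : ℕ) :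
    Complex.sin ((2 * k + 1 : ℕ) * ψ) = (chebSeq (k + 1) + chebSeq k) * Complex.sin ψ ∧
      Complex.sin ((2 * k + 3 : ℕ) * ψ) = (chebSeq (k + 2) + chebSeq (k + 1)) * Complex.sin ψ := by
  induction k with
  | zero =>
    have := sin_recurrence hψ (-ψ)
    rw [show -ψ + 2 * (2 * ψ) = 3 * ψ by ring, show -ψ + 2 * ψ = ψ by ring, Complex.sin_neg] at this
    simp [chebSeq, this]
    ring
  | succ k ih =>
    refine ⟨ih.2, ?_⟩
    have := sin_recurrence hψ ((2 * k + 1 : ℕ) * ψ)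
    rw [chebSeq_add_two (k + 1)]
    have h1 : ((2 * (k + 1) + 3 : ℕ) : ℂ) * ψ = (2 * k + 1 : ℕ) * ψ + 2 * (2 * ψ) := by
      push_cast; ring
    have h2 : ((2 * k + 1 : ℕ) : ℂ) * ψ + 2 * ψ = (2 * k + 3 : ℕ) * ψ := by push_cast; ring
    rw [h1, this, h2, ih.1, ih.2, chebSeq_add_two]
    push_cast
    ring

theorem sin_complexArccos_ne_zero : Complex.sin (complexArccos (5 / 2)) ≠ 0 := by
  intro h
  have := Complex.sin_sq_add_cos_sq (complexArccos (5 / 2))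
  rw [h, cos_complexArccos] at this
  norm_num at this

/-- The imaginary part of the principal logarithm lies in `(-π, π]`, so half the arc cosine has real
part in `[-π/2, π/2]`. This fixes the sign of the square root in `cos_half_complexArccos`. -/
theorem re_cos_half_complexArccos_nonneg (z : ℂ) : 0 ≤ (Complex.cos (complexArccos z / 2)).re := by
  have hre : (complexArccos z / 2).re =
      (Complex.log (z + Complex.I * (1 - z ^ 2) ^ (1 / 2 : ℂ))).im / 2 := by
    rw [show complexArccos z / 2 = complexArccos z / ((2 : ℝ) : ℂ) by simp, Complex.div_ofReal_re]
    simp [complexArccos]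
  rw [Complex.cos_eq, Complex.sub_re]
  set a := (complexArccos z / 2).re with ha
  set b := (complexArccos z / 2).im
  have hcos : 0 ≤ Real.cos a := by
    apply Real.cos_nonneg_of_neg_pi_div_two_le_of_le
    · have := Complex.neg_pi_lt_log_im (z + Complex.I * (1 - z ^ 2) ^ (1 / 2 : ℂ)); linarith
    · have := Complex.log_im_le_pi (z + Complex.I * (1 - z ^ 2) ^ (1 / 2 : ℂ)); linarith
  rw [← Complex.ofReal_cos, ← Complex.ofReal_cosh, ← Complex.ofReal_sin, ← Complex.ofReal_sinh,
    ← Complex.ofReal_mul, ← Complex.ofReal_mul, Complex.ofReal_re, Complex.re_ofReal_mul,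
    Complex.I_re, mul_zero, sub_zero]
  exact mul_nonneg hcos (Real.cosh_pos b).le

theorem cos_half_complexArccos : Complex.cos (complexArccos (5 / 2) / 2) = (Real.sqrt 7 : ℂ) / 2 := by
  have hre := re_cos_half_complexArccos_nonneg (5 / 2)
  set w := Complex.cos (complexArccos (5 / 2) / 2) with hw
  have h7 : (Real.sqrt 7 : ℂ) ^ 2 = 7 := by
    rw [← Complex.ofReal_pow, Real.sq_sqrt (by norm_num)]; norm_num
  have h2 := Complex.cos_two_mul (complexArccos (5 / 2) / 2)
  rw [mul_div_cancel₀ _ (two_ne_zero), cos_complexArccos, ← hw] at h2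
  have hsq : (w - (Real.sqrt 7 : ℂ) / 2) * (w + (Real.sqrt 7 : ℂ) / 2) = 0 := by
    linear_combination -h2 / 2 - h7 / 4
  rcases mul_eq_zero.1 hsq with h | h
  · exact sub_eq_zero.1 h
  · exfalso
    rw [eq_neg_of_add_eq_zero_left h] at hre
    have : (0 : ℝ) < Real.sqrt 7 := by positivity
    rw [show -((Real.sqrt 7 : ℂ) / 2) = ((-(Real.sqrt 7 / 2) : ℝ) : ℂ) by push_cast; ring,
      Complex.ofReal_re] at hre
    linarith

theorem nu_even (k : ℕ) : nu (2 * k) = chebSeq k := by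
  rw [nu, if_neg (by simp), chebyshevU]
  have := (sin_nat_mul (cos_complexArccos (5 / 2)) k).1
  rw [show (((2 * k : ℕ) : ℂ) / 2 - 1 + 1) = k by push_cast; ring, this,
    mul_div_cancel_right₀ _ sin_complexArccos_ne_zero]

theorem nu_odd (k : ℕ) : nu (2 * k + 1) = chebSeq (k + 1) + chebSeq k := by
  rw [nu, if_pos (by simp), chebyshevU]
  set ψ := complexArccos (5 / 2) / 2 with hψ
  have h2 : complexArccos (5 / 2) = 2 * ψ := by rw [hψ]; ring
  have hne := sin_complexArccos_ne_zero
  -- The factor `√7` in the odd case of `ν` is exactly `2 cos ψ`, so it cancels.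
  have hs : Complex.sin (2 * ψ) = (Real.sqrt 7 : ℂ) * Complex.sin ψ := by
    rw [Complex.sin_two_mul, hψ, cos_half_complexArccos]; ring
  have hc := cos_complexArccos (5 / 2)
  rw [h2] at hne hc ⊢
  rw [hs] at hne ⊢
  have := (sin_odd_mul hc k).1
  rw [show (((2 * k + 1 : ℕ) : ℂ) / 2 - 1 + 1) * (2 * ψ) = ((2 * k + 1 : ℕ) : ℂ) * ψ by ring, this]
  obtain ⟨h7, hsin⟩ := mul_ne_zero_iff.1 hne
  field_simp

/-! ### Tripling and septupling formulas. -/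

/-- The formula for `sin 3x` at `x = kθ`, with `sin² θ = 1 - 25/4 = -21/4`. -/
theorem chebSeq_three_mul (k : ℕ) :
    chebSeq (3 * k) = 3 * chebSeq k * (7 * chebSeq k ^ 2 + 1) := by
  have hc := cos_complexArccos (5 / 2)
  have hne := sin_complexArccos_ne_zero
  set θ := complexArccos (5 / 2)
  have hsq := Complex.sin_sq_add_cos_sq θ
  rw [hc] at hsq
  have h1 := (sin_nat_mul hc k).1
  have h3 := (sin_nat_mul hc (3 * k)).1
  have ht := Complex.sin_three_mul (k * θ)
  rw [show 3 * ((k : ℂ) * θ) = (3 * k : ℕ) * θ by push_cast; ring, h1, h3] at ht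
  have : (chebSeq (3 * k) : ℂ) = 3 * chebSeq k * (7 * chebSeq k ^ 2 + 1) := by
    apply mul_right_cancel₀ hne
    linear_combination ht - 4 * (chebSeq k : ℂ) ^ 3 * Complex.sin θ * hsq
  exact_mod_cast this

theorem chebSeq_odd_three_mul (k : ℕ) :
    chebSeq (3 * k + 2) + chebSeq (3 * k + 1) =
      3 * (chebSeq (k + 1) + chebSeq k) * ((chebSeq (k + 1) + chebSeq k) ^ 2 + 1) := by
  set ψ := complexArccos (5 / 2) / 2 with hψ
  have h2 : complexArccos (5 / 2) = 2 * ψ := by rw [hψ]; ring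
  have hc := cos_complexArccos (5 / 2)
  rw [h2] at hc
  have hsq : Complex.sin ψ ^ 2 = -3 / 4 := by
    have := Complex.cos_two_mul ψ
    have h' := Complex.sin_sq_add_cos_sq ψ
    linear_combination h' + this / 2 - hc / 2
  have hne : Complex.sin ψ ≠ 0 := by
    intro h; rw [h] at hsq; norm_num at hsq
  have h1 := (sin_odd_mul hc k).1
  have h3 := (sin_odd_mul hc (3 * k + 1)).1
  have ht := Complex.sin_three_mul ((2 * k + 1 : ℕ) * ψ)
  rw [show 3 * (((2 * k + 1 : ℕ) : ℂ) * ψ) = (2 * (3 * k + 1) + 1 : ℕ) * ψ by push_cast; ring,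
    h1, h3] at ht
  have : (chebSeq (3 * k + 2) : ℂ) + chebSeq (3 * k + 1) =
      3 * (chebSeq (k + 1) + chebSeq k) * ((chebSeq (k + 1) + chebSeq k) ^ 2 + 1) := by
    apply mul_right_cancel₀ hne
    linear_combination ht - 4 * ((chebSeq (k + 1) : ℂ) + chebSeq k) ^ 3 * Complex.sin ψ * hsq
  exact_mod_cast this

theorem sin_seven_mul (z : ℂ) :
    Complex.sin (7 * z) = 7 * Complex.sin z - 56 * Complex.sin z ^ 3 + 112 * Complex.sin z ^ 5
      - 64 * Complex.sin z ^ 7 := by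
  have h : Complex.sin (7 * z) + Complex.sin z = 2 * Complex.sin (4 * z) * Complex.cos (3 * z) := by
    rw [show 7 * z = 4 * z + 3 * z by ring, Complex.sin_add,
      show Complex.sin z = Complex.sin (4 * z - 3 * z) by ring_nf, Complex.sin_sub]
    ring
  rw [show 4 * z = 2 * (2 * z) by ring, Complex.sin_two_mul, Complex.sin_two_mul,
    Complex.cos_two_mul, Complex.cos_three_mul] at h
  have hc := Complex.cos_sq' z
  have h4 : Complex.cos z ^ 4 = (1 - Complex.sin z ^ 2) ^ 2 := by rw [← hc]; ring
  have h6 : Complex.cos z ^ 6 = (1 - Complex.sin z ^ 2) ^ 3 := by rw [← hc]; ring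
  linear_combination h + 24 * Complex.sin z * hc - 80 * Complex.sin z * h4 + 64 * Complex.sin z * h6

/-- In the formula for `sin 7x` only the leading coefficient `64` is prime to 7, and it comes with
`(sin² θ)³ = (-21/4)³`, which supplies the missing factor 7. -/
theorem seven_mul_dvd_chebSeq (k : ℕ) : 7 * chebSeq k ∣ chebSeq (7 * k) := by
  have hc := cos_complexArccos (5 / 2)
  have hne := sin_complexArccos_ne_zero
  set θ := complexArccos (5 / 2)
  have hsq : Complex.sin θ ^ 2 = -21 / 4 := by
    have := Complex.sin_sq_add_cos_sq θ
    rw [hc] at this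
    linear_combination this
  have h4 : Complex.sin θ ^ 4 = (-21 / 4) ^ 2 := by rw [← hsq]; ring
  have h6 : Complex.sin θ ^ 6 = (-21 / 4) ^ 3 := by rw [← hsq]; ring
  have h1 := (sin_nat_mul hc k).1
  have h7 := (sin_nat_mul hc (7 * k)).1
  have ht := sin_seven_mul (k * θ)
  rw [show 7 * ((k : ℂ) * θ) = (7 * k : ℕ) * θ by push_cast; ring, h1, h7] at ht
  have : (chebSeq (7 * k) : ℂ) = 7 * chebSeq k *
      (1 + 42 * chebSeq k ^ 2 + 441 * chebSeq k ^ 4 + 1323 * chebSeq k ^ 6) := by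
    apply mul_right_cancel₀ hne
    linear_combination ht - 56 * (chebSeq k : ℂ) ^ 3 * Complex.sin θ * hsq
      + 112 * (chebSeq k : ℂ) ^ 5 * Complex.sin θ * h4
      - 64 * (chebSeq k : ℂ) ^ 7 * Complex.sin θ * h6
  exact ⟨_, by exact_mod_cast this⟩

/-! ### Smith form of a triangular pair of rows. -/

theorem exists_coprime_add_mul {a : ℕ} (ha : a ≠ 0) {b w : ℤ}
    (h : ∀ p : ℕ, p.Prime → (p : ℤ) ∣ a → (p : ℤ) ∣ b → ¬ (p : ℤ) ∣ w) :
    ∃ k : ℤ, IsCoprime (a : ℤ) (b + k * w) := by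
  classical
  -- For a prime `p ∣ a`, exactly one of `b` and `k * w` is divisible by `p`: the product contains
  -- `p` precisely when `p ∤ b`.
  refine ⟨∏ p ∈ a.primeFactors.filter fun p : ℕ => ¬ (p : ℤ) ∣ b, (p : ℤ), ?_⟩
  rw [Int.isCoprime_iff_gcd_eq_one]
  by_contra hne
  obtain ⟨p, hp, hpd⟩ := Nat.exists_prime_and_dvd hne
  have hpa : (p : ℤ) ∣ a := (Int.natCast_dvd_natCast.2 hpd).trans (Int.gcd_dvd_left ..)
  have hps := (Int.natCast_dvd_natCast.2 hpd).trans (Int.gcd_dvd_right (a := (a : ℤ)) ..)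
  have hpI : Prime (p : ℤ) := Nat.prime_iff_prime_int.1 hp
  by_cases hb : (p : ℤ) ∣ b
  · have h1 := (dvd_add_right hb).1 hps
    rcases hpI.dvd_or_dvd h1 with h2 | h2
    · obtain ⟨q, hq, hpq⟩ := (hpI.dvd_finsetProd_iff _).1 h2
      rw [Finset.mem_filter, Nat.mem_primeFactors] at hq
      have := (Nat.prime_dvd_prime_iff_eq hp hq.1.1).1 (by exact_mod_cast hpq)
      exact hq.2 (this ▸ hb)
    · exact h p hp hpa hb h2
  · refine hb ((dvd_add_left (Dvd.dvd.mul_right (Finset.dvd_prod_of_mem _ ?_) _)).1 hps)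
    rw [Finset.mem_filter, Nat.mem_primeFactors]
    exact ⟨⟨hp, by exact_mod_cast hpa, ha⟩, hb⟩

/-- Smith normal form of a nonsingular upper triangular `2 × 2` integer matrix. -/
theorem exists_smith_two {a w d : ℕ} {b : ℤ} (ha : 0 < a) (hw : 0 < w)
    (hda : d ∣ a) (hdb : (d : ℤ) ∣ b) (hdw : d ∣ w)
    (hd : ∀ e : ℕ, e ∣ a → (e : ℤ) ∣ b → e ∣ w → e ∣ d) :
    ∃ f : ℤ × ℤ →+ ZMod d × ZMod (a * w / d), Function.Surjective f ∧
      ∀ x y, f (x, y) = 0 ↔ ∃ s t : ℤ, x = s * a ∧ y = s * b + t * w := by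
  obtain ⟨a', rfl⟩ := hda
  obtain ⟨b', rfl⟩ := hdb
  obtain ⟨w', rfl⟩ := hdw
  have hd0 : 0 < d := Nat.pos_of_mul_pos_right ha
  have ha' : a' ≠ 0 := by rintro rfl; simp at ha
  obtain ⟨k, hk⟩ := exists_coprime_add_mul (b := b') (w := (w' : ℤ)) ha' (by
    intro p hp h1 h2 h3
    have := hd (d * p) (mul_dvd_mul_left d (by exact_mod_cast h1))
      (by push_cast; exact mul_dvd_mul_left _ h2) (mul_dvd_mul_left d (by exact_mod_cast h3))
    exact hp.one_lt.ne' (Nat.dvd_one.1 ((Nat.mul_dvd_mul_iff_left hd0).1 (by simpa using this))))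
  obtain ⟨r, t, hrt⟩ := hk
  set β := b' + k * w' with hβ
  rw [show d * a' * (d * w') / d = d * a' * w' by
    rw [show d * a' * (d * w') = d * a' * w' * d by ring, Nat.mul_div_cancel _ hd0]]
  -- With `r a' + t β = 1`, the matrix with rows `(r, t)` and `(-β, a')` is unimodular. It sends
  -- `d(a', β)` to `(d, 0)` and `d(0, w')` to `d(t w', a' w')`, so the image lattice is `dℤ × d a'
  -- w' ℤ`.
  refine ⟨AddMonoidHom.prod
    ((Int.castAddHom _).comp (r • AddMonoidHom.fst ℤ ℤ + t • AddMonoidHom.snd ℤ ℤ))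
    ((Int.castAddHom _).comp ((-β) • AddMonoidHom.fst ℤ ℤ + (a' : ℤ) • AddMonoidHom.snd ℤ ℤ)),
    ?_, ?_⟩
  · rintro ⟨X, Y⟩
    obtain ⟨X, rfl⟩ := ZMod.intCast_surjective X
    obtain ⟨Y, rfl⟩ := ZMod.intCast_surjective Y
    refine ⟨(a' * X - t * Y, β * X + r * Y), ?_⟩
    ext
    · simp only [AddMonoidHom.prod_apply, AddMonoidHom.comp_apply, Int.coe_castAddHom,
        AddMonoidHom.add_apply, AddMonoidHom.smul_apply, AddMonoidHom.coe_fst,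
        AddMonoidHom.coe_snd, smul_eq_mul]
      congr 1
      linear_combination X * hrt
    · simp only [AddMonoidHom.prod_apply, AddMonoidHom.comp_apply, Int.coe_castAddHom,
        AddMonoidHom.add_apply, AddMonoidHom.smul_apply, AddMonoidHom.coe_fst,
        AddMonoidHom.coe_snd, smul_eq_mul]
      congr 1
      linear_combination Y * hrt
  · intro x y
    simp only [AddMonoidHom.prod_apply, AddMonoidHom.comp_apply, Int.coe_castAddHom,
        AddMonoidHom.add_apply, AddMonoidHom.smul_apply, AddMonoidHom.coe_fst,
        AddMonoidHom.coe_snd, smul_eq_mul, Prod.mk_eq_zero, ZMod.intCast_zmod_eq_zero_iff_dvd]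
    constructor
    · rintro ⟨⟨i, hi⟩, ⟨j, hj⟩⟩
      push_cast at hj ⊢
      refine ⟨i - t * w' * j, k * (i - t * w' * j) + j, ?_, ?_⟩
      · linear_combination a' * hi - t * hj - x * hrt
      · linear_combination β * hi + r * hj - y * hrt + d * i * hβ - w' * j * d * hrt
          + (-d * t * w' * j) * hβ + 2 * w' * j * d * hrt
    · rintro ⟨s, u, rfl, rfl⟩
      push_cast
      exact ⟨⟨s + t * w' * (u - s * k), by linear_combination s * d * hrt - d * t * s * hβ⟩,
        ⟨u - s * k, by rw [hβ]; ring⟩⟩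

/-! ### Comparing `v` and `n` at the primes 3 and 7. -/

/-- The first tripling multiplies the cofactor by `l f² + 1 ≡ 2 ≡ -1` modulo 3. From then on `f ≡
0`, so every later factor is `≡ 1`. -/
theorem three_adic_growth {P : ℕ → Prop} {f : ℕ → ℤ} {l : ℤ} (hl : l ≡ 1 [ZMOD 3])
    (hP : ∀ k, P k → P (3 * k)) (hf : ∀ k, P k → f k ≡ k [ZMOD 3])
    (h3 : ∀ k, P k → f (3 * k) = 3 * f k * (l * f k ^ 2 + 1)) {m : ℕ} (hPm : P m)
    (hm : ¬ 3 ∣ m) (r : ℕ) :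
    P (3 ^ (r + 1) * m) ∧ ∃ q : ℤ, f (3 ^ (r + 1) * m) = 3 ^ (r + 1) * q ∧ q ≡ -m [ZMOD 3] := by
  induction r with
  | zero =>
    refine ⟨by simpa using hP m hPm, f m * (l * f m ^ 2 + 1), ?_, ?_⟩
    · rw [zero_add, pow_one, pow_one, h3 m hPm]; ring
    · have h1 : f m * (l * f m ^ 2 + 1) ≡ m * (1 * m ^ 2 + 1) [ZMOD 3] := by
        gcongr
        exacts [hf m hPm, hf m hPm]
      refine h1.trans ?_
      have h2 : (m : ℤ) ≡ 1 [ZMOD 3] ∨ (m : ℤ) ≡ 2 [ZMOD 3] := by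
        simp only [Int.ModEq]; omega
      rcases h2 with h | h
      · calc (m : ℤ) * (1 * m ^ 2 + 1) ≡ 1 * (1 * 1 ^ 2 + 1) [ZMOD 3] := by gcongr
          _ ≡ -1 [ZMOD 3] := by decide
          _ ≡ -m [ZMOD 3] := (Int.ModEq.neg h).symm
      · calc (m : ℤ) * (1 * m ^ 2 + 1) ≡ 2 * (1 * 2 ^ 2 + 1) [ZMOD 3] := by gcongr
          _ ≡ -2 [ZMOD 3] := by decide
          _ ≡ -m [ZMOD 3] := (Int.ModEq.neg h).symm
  | succ r ih =>
    obtain ⟨hPr, q, hq, hqm⟩ := ih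
    have he : 3 ^ (r + 1 + 1) * m = 3 * (3 ^ (r + 1) * m) := by ring
    refine ⟨he ▸ hP _ hPr, q * (l * f (3 ^ (r + 1) * m) ^ 2 + 1), ?_, ?_⟩
    · rw [he, h3 _ hPr]
      nth_rewrite 1 [hq]
      ring
    · have h0 : f (3 ^ (r + 1) * m) ≡ 0 [ZMOD 3] := by
        rw [hq, Int.modEq_zero_iff_dvd, pow_succ]
        exact ⟨3 ^ r * q, by ring⟩
      calc q * (l * f (3 ^ (r + 1) * m) ^ 2 + 1) ≡ -m * (l * 0 ^ 2 + 1) [ZMOD 3] := by gcongr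
        _ = -m := by ring

/-- The effect on greatest common divisors of `v = f k` and `k` having the same power of `3` but
opposite cofactors modulo `3`. -/
theorem gcd_mul_gcd_three {P : ℕ → Prop} {f : ℕ → ℤ} {l : ℤ} (hl : l ≡ 1 [ZMOD 3])
    (hP : ∀ k, P k → P (3 * k)) (hP' : ∀ k m, P (m * k) → P k)
    (hf : ∀ k, P k → f k ≡ k [ZMOD 3])
    (h3 : ∀ k, P k → f (3 * k) = 3 * f k * (l * f k ^ 2 + 1)) {k : ℕ} (hk : 0 < k) (hPk : P k)
    {ε : ℕ} (hε : ¬ 3 ∣ ε) {c : ℤ} (hc : 3 * c = ε * (f k - k)) :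
    Int.gcd (f k) c * Nat.gcd (ε * k) 3 = Int.gcd (ε * k) (f k) := by
  have hε' : IsCoprime (3 : ℤ) ε := by
    rw [show (3 : ℤ) = ((3 : ℕ) : ℤ) from rfl, Nat.isCoprime_iff_coprime]
    exact (Nat.Prime.coprime_iff_not_dvd Nat.prime_three).2 hε
  have hg : ∀ {q m x : ℤ}, x = ε * (q - m) → Int.gcd q x = Int.gcd (ε * m) q := by
    rintro q m x rfl
    rw [Int.gcd_comm, show (ε : ℤ) * (q - m) = -(ε * m) + ε * q by ring,
      Int.gcd_add_mul_right_left, Int.neg_gcd]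
  by_cases h : 3 ∣ k
  · obtain ⟨r, m, hm, rfl⟩ := Nat.exists_eq_pow_mul_and_not_dvd hk.ne' 3 (by norm_num)
    have hr : r ≠ 0 := by rintro rfl; exact hm (by simpa using h)
    obtain ⟨r, rfl⟩ := Nat.exists_eq_add_one.2 (Nat.pos_of_ne_zero hr)
    obtain ⟨q, hq, hqm⟩ := (three_adic_growth hl hP hf h3 (hP' _ _ hPk) hm r).2
    have h33 : Nat.gcd (ε * (3 ^ (r + 1) * m)) 3 = 3 :=
      Nat.gcd_eq_right (h.mul_left _)
    have hcc : c = 3 ^ r * (ε * (q - m)) := by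
      rw [hq] at hc
      push_cast at hc
      have : (3 : ℤ) * c = 3 * (3 ^ r * (ε * (q - m))) := by rw [hc]; ring
      linarith
    -- Here `q - m ≡ -2m` is nonzero modulo 3. So `c` carries exactly one power of 3 fewer than `f
    -- k`, the power restored by `gcd(εk, 3) = 3`.
    have hcop : IsCoprime (3 : ℤ) (ε * (q - m)) := by
      refine hε'.mul_right ?_
      rw [Prime.coprime_iff_not_dvd Int.prime_three]
      simp only [Int.ModEq] at hqm
      omega
    have h1 : Int.gcd (3 * q) (ε * (q - m)) = Int.gcd (ε * m) q := by
      rw [Int.gcd_mul_right_left_of_gcd_eq_one (Int.isCoprime_iff_gcd_eq_one.1 hcop), hg rfl]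
    rw [h33, hq, hcc, show (ε : ℤ) * ((3 ^ (r + 1) * m : ℕ) : ℤ) = 3 ^ (r + 1) * (ε * m) by
      push_cast; ring, Int.gcd_mul_left, pow_succ, mul_assoc, Int.gcd_mul_left, h1,
      Int.natAbs_mul]
    simp only [Int.reduceAbs]
    ring
  · have h1 : Nat.gcd (ε * k) 3 = 1 := by
      rw [← Nat.coprime_iff_gcd_eq_one, Nat.coprime_comm,
        Nat.Prime.coprime_iff_not_dvd Nat.prime_three, Nat.prime_three.dvd_mul]
      tauto
    have hcop : IsCoprime (f k) 3 := by
      rw [isCoprime_comm, Prime.coprime_iff_not_dvd Int.prime_three]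
      have := hf k hPk
      simp only [Int.ModEq] at this
      omega
    rw [h1, mul_one, ← hg hc,
      Int.gcd_mul_right_right_of_gcd_eq_one (Int.isCoprime_iff_gcd_eq_one.1 hcop)]

theorem seven_pow_dvd_chebSeq (m s : ℕ) : (7 : ℤ) ^ s ∣ chebSeq (7 ^ s * m) := by
  induction s with
  | zero => simp
  | succ s ih =>
    rw [pow_succ' 7 s, pow_succ' 7 s, mul_assoc]
    exact (mul_dvd_mul_left 7 ih).trans (seven_mul_dvd_chebSeq _)

/-- The sequence at `k` is divisible by at least the power of 7 in `k`, so the 7-part of a divisor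
of `2k` already divides it. This removes the extra 7 from the even-case lattice when computing its
first invariant. -/
theorem dvd_chebSeq_of_dvd {k : ℕ} (hk : 0 < k) {d : ℤ} (h1 : d ∣ 2 * k)
    (h2 : d ∣ 7 * chebSeq k) : d ∣ chebSeq k := by
  obtain ⟨s, m, hm, rfl⟩ := Nat.exists_eq_pow_mul_and_not_dvd hk.ne' 7 (by norm_num)
  obtain ⟨w, hw⟩ := seven_pow_dvd_chebSeq m s
  have hcop : IsCoprime (7 : ℤ) (2 * m) := by
    rw [Prime.coprime_iff_not_dvd (by norm_num)]
    omega
  obtain ⟨a, b, hab⟩ := hcop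
  have : chebSeq (7 ^ s * m) =
      a * (7 * chebSeq (7 ^ s * m)) + b * w * (2 * ((7 ^ s * m : ℕ) : ℤ)) := by
    push_cast
    rw [hw]
    linear_combination (-(7 : ℤ) ^ s * w) * hab
  rw [this]
  exact dvd_add (h2.mul_left _) (h1.mul_left _)

/-! ### The ring `ℤ[x]/(cubic)` and its basis. -/

open Polynomial in
/-- The polynomial `(X - 1)(X² - 5X + 1)`. -/
noncomputable def cubic : ℤ[X] := (X - 1) * (X ^ 2 - 5 * X + 1)

open Polynomial in
theorem cubic_eq : cubic = X ^ 3 - 6 * X ^ 2 + 6 * X - 1 := by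
  rw [cubic]; ring

open Polynomial in
theorem cubic_natDegree : cubic.natDegree = 3 := by
  rw [cubic_eq, show (6 : ℤ[X]) = C 6 by simp]; compute_degree!

open Polynomial in
theorem monic_cubic : cubic.Monic := by
  rw [Monic, leadingCoeff, cubic_natDegree, cubic_eq]
  simp [coeff_X, coeff_one]

local notation "ξ" => AdjoinRoot.root cubic

theorem root_cubic : ξ ^ 3 - 6 * ξ ^ 2 + 6 * ξ - 1 = 0 := by
  have h := congrArg (AdjoinRoot.mk cubic) cubic_eq
  rw [AdjoinRoot.mk_self] at h
  have h6 : AdjoinRoot.mk cubic 6 = 6 := map_ofNat _ 6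
  simpa [h6] using h.symm

theorem isUnit_root_cubic : IsUnit ξ :=
  .of_mul_eq_one (ξ ^ 2 - 6 * ξ + 6) (by linear_combination root_cubic)

/-- The map `ℤ³ → ℤ[x] / (cubic)` given by the basis `1, x, x² - 5x + 1`. -/
noncomputable def cubicCoords : ℤ × ℤ × ℤ →+ AdjoinRoot cubic where
  toFun a := a.1 + a.2.1 * ξ + a.2.2 * (ξ ^ 2 - 5 * ξ + 1)
  map_zero' := by simp
  map_add' a b := by simp only [Prod.fst_add, Prod.snd_add]; push_cast; ring

theorem cubicCoords_apply (a b c : ℤ) :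
    cubicCoords (a, b, c) = a + b * ξ + c * (ξ ^ 2 - 5 * ξ + 1) := rfl

open Polynomial in
theorem cubicCoords_bijective : Function.Bijective cubicCoords := by
  constructor
  · rw [injective_iff_map_eq_zero]
    rintro ⟨a, b, c⟩ h
    have h1 : AdjoinRoot.mk cubic (C c * X ^ 2 + C (b - 5 * c) * X + C (a + c)) = 0 := by
      rw [← h, cubicCoords_apply]
      simp only [map_add, map_mul, map_pow, AdjoinRoot.mk_X, eq_intCast,
        map_intCast]
      push_cast
      ring
    rw [AdjoinRoot.mk_eq_zero] at h1
    have h2 : C c * X ^ 2 + C (b - 5 * c) * X + C (a + c) = 0 := by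
      by_contra hne
      have := natDegree_le_of_dvd h1 hne
      have h3 := natDegree_quadratic_le (a := c) (b := b - 5 * c) (c := a + c)
      rw [cubic_natDegree] at this
      omega
    have e0 := congrArg (coeff · 0) h2
    have e1 := congrArg (coeff · 1) h2
    have e2 := congrArg (coeff · 2) h2
    simp only [coeff_add, coeff_C_mul, coeff_X_pow, coeff_X, coeff_C, coeff_zero] at e0 e1 e2
    norm_num at e0 e1 e2
    simp only [Prod.mk_eq_zero]
    omega
  · intro r
    obtain ⟨p, rfl⟩ := AdjoinRoot.mk_surjective r
    have hdeg : (p %ₘ cubic).natDegree < 3 := by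
      rw [← cubic_natDegree]
      exact natDegree_modByMonic_lt _ monic_cubic (by
        intro h; have := cubic_natDegree; rw [h, natDegree_one] at this; omega)
    have hp := as_sum_range' _ _ hdeg
    have hmk : AdjoinRoot.mk cubic p = AdjoinRoot.mk cubic (p %ₘ cubic) := by
      rw [AdjoinRoot.mk_eq_mk]
      exact ⟨p /ₘ cubic, by linear_combination -(modByMonic_add_div p cubic)⟩
    set q := p %ₘ cubic
    refine ⟨(q.coeff 0 - q.coeff 2, q.coeff 1 + 5 * q.coeff 2, q.coeff 2), ?_⟩
    rw [hmk, cubicCoords_apply]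
    conv_rhs => rw [hp]
    simp only [Finset.sum_range_succ, Finset.sum_range_zero, ← C_mul_X_pow_eq_monomial, map_add,
      map_mul, map_pow, AdjoinRoot.mk_X, eq_intCast, map_intCast, map_zero]
    push_cast
    ring

/-- `ℤ[x] / (cubic)` is free with basis `1, x, x² - 5x + 1`. -/
noncomputable def cubicEquiv : AdjoinRoot cubic ≃+ ℤ × ℤ × ℤ :=
  (AddEquiv.ofBijective cubicCoords cubicCoords_bijective).symm

theorem cubicEquiv_eq_iff {r : AdjoinRoot cubic} {a b c : ℤ} :
    cubicEquiv r = (a, b, c) ↔ r = a + b * ξ + c * (ξ ^ 2 - 5 * ξ + 1) := by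
  rw [cubicEquiv, AddEquiv.symm_apply_eq, AddEquiv.ofBijective_apply, cubicCoords_apply]

theorem exists_eq_coords (r : AdjoinRoot cubic) :
    ∃ a b c : ℤ, r = a + b * ξ + c * (ξ ^ 2 - 5 * ξ + 1) :=
  ⟨_, _, _, cubicEquiv_eq_iff.1 rfl⟩

/-! ### Geometric sums at the root, up to units. -/

/-- As functions of `m`, these sums have characteristic roots `1` and `y`, hence `1` and `y²` in
steps of two. -/
theorem geom_sum_recurrence {R : Type*} [CommRing R] (y : R) (m : ℕ) :
    ∑ i ∈ Finset.range (m + 4), y ^ i = (y ^ 2 + 1) * ∑ i ∈ Finset.range (m + 2), y ^ i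
      - y ^ 2 * ∑ i ∈ Finset.range m, y ^ i := by
  simp only [Finset.sum_range_succ]
  ring

theorem exists_geom_sum_odd (k : ℕ) :
    (∃ c : ℤ, ∑ i ∈ Finset.range (2 * k + 1), ξ ^ i = ξ ^ k *
      ((chebSeq (k + 1) + chebSeq k : ℤ) + c * (ξ ^ 2 - 5 * ξ + 1))) ∧
    ∃ c : ℤ, ∑ i ∈ Finset.range (2 * k + 3), ξ ^ i = ξ ^ (k + 1) *
      ((chebSeq (k + 2) + chebSeq (k + 1) : ℤ) + c * (ξ ^ 2 - 5 * ξ + 1)) := by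
  induction k with
  | zero =>
    refine ⟨⟨0, by simp [chebSeq]⟩, 1, ?_⟩
    simp only [mul_zero, zero_add, Finset.sum_range_succ, Finset.sum_range_zero, chebSeq]
    push_cast
    linear_combination -root_cubic
  | succ k ih =>
    refine ⟨ih.2, ?_⟩
    obtain ⟨⟨c, hc⟩, c', hc'⟩ := ih
    -- After division by the power of `ξ`, the recurrence multiplies by `ξ + ξ⁻¹`. This acts as 2 on
    -- `E = ξ² - 5ξ + 1`, giving `2c'`, and equals `5 + ξ⁻¹E`, giving the extra Chebyshev term.
    refine ⟨2 * c' + (chebSeq (k + 2) + chebSeq (k + 1)) - c, ?_⟩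
    have h := geom_sum_recurrence ξ (2 * k + 1)
    rw [show 2 * (k + 1) + 3 = 2 * k + 1 + 4 by ring, h, hc', hc, chebSeq_add_two (k + 1),
      chebSeq_add_two k]
    push_cast
    linear_combination (ξ ^ (k + 2) * c' * (ξ - 4) - ξ ^ (k + 1) *
      ((5 * chebSeq (k + 1) - chebSeq k + chebSeq (k + 1)) + c' * (ξ ^ 2 - 5 * ξ + 1))) * root_cubic

/-- The natural power here is `ξ^(k-1)`; the extra factor `ξ` avoids a negative exponent at `k = 0`.
-/
theorem exists_geom_sum_even (k : ℕ) :
    (∃ c : ℤ, ξ * ∑ i ∈ Finset.range (2 * k), ξ ^ i = ξ ^ k *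
      (chebSeq k * (1 + ξ) + c * (ξ ^ 2 - 5 * ξ + 1))) ∧
    ∃ c : ℤ, ξ * ∑ i ∈ Finset.range (2 * k + 2), ξ ^ i = ξ ^ (k + 1) *
      (chebSeq (k + 1) * (1 + ξ) + c * (ξ ^ 2 - 5 * ξ + 1)) := by
  induction k with
  | zero => exact ⟨⟨0, by simp [chebSeq]⟩, 0, by simp [chebSeq, Finset.sum_range_succ]⟩
  | succ k ih =>
    refine ⟨ih.2, ?_⟩
    obtain ⟨⟨c, hc⟩, c', hc'⟩ := ih
    refine ⟨2 * c' + 2 * chebSeq (k + 1) - c, ?_⟩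
    have h := geom_sum_recurrence ξ (2 * k)
    rw [show 2 * (k + 1) + 2 = 2 * k + 4 by ring, h, chebSeq_add_two k]
    push_cast
    linear_combination (ξ ^ 2 + 1) * hc' - ξ ^ 2 * hc +
      (ξ ^ (k + 2) * (c' * (ξ - 4) + chebSeq (k + 1)) - ξ ^ (k + 1) *
      (chebSeq (k + 1) * (1 + ξ) + c' * (ξ ^ 2 - 5 * ξ + 1))) * root_cubic

open Polynomial in
/-- The augmentation `ℤ[x] / (cubic) → ℤ`, `x ↦ 1`. -/
noncomputable def cubicAug : AdjoinRoot cubic →+* ℤ :=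
  AdjoinRoot.lift (RingHom.id ℤ) 1 (by simp [cubic])

theorem cubicAug_root : cubicAug ξ = 1 := by simp [cubicAug]

/-- Powers of `ξ` are units, and the augmentation sends `ξ² - 5ξ + 1` to `-3`, which ties `c` to `n`
and `v`. -/
theorem exists_associated_odd (k : ℕ) : ∃ c : ℤ,
    ((2 * k + 1 : ℕ) : ℤ) = (chebSeq (k + 1) + chebSeq k) - 3 * c ∧
    Associated (∑ i ∈ Finset.range (2 * k + 1), ξ ^ i)
      ((chebSeq (k + 1) + chebSeq k : ℤ) + c * (ξ ^ 2 - 5 * ξ + 1)) := by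
  obtain ⟨⟨c, hc⟩, -⟩ := exists_geom_sum_odd k
  refine ⟨c, ?_, ?_⟩
  · have h := congrArg cubicAug hc
    simp only [map_sum, map_pow, cubicAug_root, one_pow, Finset.sum_const, Finset.card_range,
      nsmul_eq_mul, mul_one, map_mul, map_add, map_sub, map_intCast, map_ofNat, map_one,
      Int.cast_id] at h
    rw [h]
    ring
  · rw [hc]
    exact associated_unit_mul_left _ _ (isUnit_root_cubic.pow k)

theorem exists_associated_even (k : ℕ) : ∃ c : ℤ,
    ((2 * k : ℕ) : ℤ) = 2 * chebSeq k - 3 * c ∧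
    Associated (∑ i ∈ Finset.range (2 * k), ξ ^ i)
      (chebSeq k * (1 + ξ) + c * (ξ ^ 2 - 5 * ξ + 1)) := by
  obtain ⟨⟨c, hc⟩, -⟩ := exists_geom_sum_even k
  refine ⟨c, ?_, ?_⟩
  · have h := congrArg cubicAug hc
    simp only [map_sum, map_pow, cubicAug_root, one_pow, Finset.sum_const, Finset.card_range,
      nsmul_eq_mul, mul_one, one_mul, map_mul, map_add, map_sub, map_intCast, map_ofNat, map_one,
      Int.cast_id] at h
    rw [h]
    ring
  · refine (associated_unit_mul_right _ _ isUnit_root_cubic).trans ?_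
    rw [hc]
    exact associated_unit_mul_left _ _ (isUnit_root_cubic.pow k)

/-! ### Diagonalising the ideal generated by the geometric sum. -/

/-- Coordinates on `ℤ³` in which the ideal generated by `v + c (x² - 5x + 1)` splits. -/
def oddCoords : ℤ × ℤ × ℤ ≃+ (ℤ × ℤ) × ℤ where
  toFun a := ((a.1 + a.2.1, a.2.2), a.2.1)
  invFun b := (b.1.1 - b.2, b.2, b.1.2)
  left_inv a := by simp
  right_inv b := by simp
  map_add' a b := by ext <;> simp <;> ring

/-- Coordinates on `ℤ³` in which the ideal generated by `v (1 + x) + c (x² - 5x + 1)` splits. -/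
def evenCoords : ℤ × ℤ × ℤ ≃+ (ℤ × ℤ) × ℤ where
  toFun a := ((a.1 + a.2.1 - 3 * a.2.2, a.1 + 2 * a.2.2), 2 * a.1 + a.2.1)
  invFun b := (b.1.2 - 2 * (b.2 - b.1.1 - b.1.2), b.2 - 2 * (b.1.2 - 2 * (b.2 - b.1.1 - b.1.2)),
    b.2 - b.1.1 - b.1.2)
  left_inv a := by ext <;> simp <;> ring
  right_inv b := by ext <;> simp <;> ring
  map_add' a b := by ext <;> simp <;> ring

theorem exists_hom_prod {R A : Type*} [AddCommGroup R] [AddCommGroup A] (e : R ≃+ (ℤ × ℤ) × ℤ)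
    {f : ℤ × ℤ →+ A} (hf : Function.Surjective f) (v : ℕ) :
    ∃ φ : R →+ A × ZMod v, Function.Surjective φ ∧
      ∀ r, φ r = 0 ↔ f (e r).1 = 0 ∧ (v : ℤ) ∣ (e r).2 := by
  refine ⟨(f.prodMap (Int.castAddHom (ZMod v))).comp e.toAddMonoidHom, ?_, fun r => ?_⟩
  · exact (Function.Surjective.prodMap hf ZMod.intCast_surjective).comp e.surjective
  · rw [← ZMod.intCast_zmod_eq_zero_iff_dvd]
    exact Prod.ext_iff

/-- With `E = ξ² - 5ξ + 1` and `E² = -3E`, multiplying the generator by `1, ξ, E` gives the rows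
`(v, 0, c)`, `(0, v, c)`, `(0, 0, n)`. In `oddCoords` they span `vℤ` and the lattice of `(v, c)` and
`(0, n)`. -/
theorem exists_hom_odd {v n d : ℕ} {c : ℤ} (hv : 0 < v) (hn : 0 < n) (hnv : (n : ℤ) = v - 3 * c)
    (hd : d = Int.gcd v c) :
    ∃ φ : AdjoinRoot cubic →+ (ZMod d × ZMod (v * n / d)) × ZMod v, Function.Surjective φ ∧
      ∀ r, φ r = 0 ↔ (v : AdjoinRoot cubic) + c * (ξ ^ 2 - 5 * ξ + 1) ∣ r := by
  have hdv : (d : ℤ) ∣ v := hd ▸ Int.gcd_dvd_left ..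
  have hdc : (d : ℤ) ∣ c := hd ▸ Int.gcd_dvd_right ..
  have hdn : (d : ℤ) ∣ n := hnv ▸ dvd_sub hdv (hdc.mul_left 3)
  obtain ⟨f, hf, hker⟩ := exists_smith_two hv hn (Int.natCast_dvd_natCast.1 hdv) hdc
    (Int.natCast_dvd_natCast.1 hdn) (by
      intro e h1 h2 _
      rw [hd]
      exact Int.natCast_dvd_natCast.1 (Int.dvd_coe_gcd (by exact_mod_cast h1) h2))
  obtain ⟨φ, hφ, hφk⟩ := exists_hom_prod (cubicEquiv.trans oddCoords) hf v
  have hF := root_cubic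
  have hnR : (n : AdjoinRoot cubic) = v - 3 * c := by
    exact_mod_cast congrArg (Int.cast (R := AdjoinRoot cubic)) hnv
  refine ⟨φ, hφ, fun r => ?_⟩
  obtain ⟨p₀, p₁, p₂, hr⟩ := exists_eq_coords r
  rw [hφk, AddEquiv.trans_apply, cubicEquiv_eq_iff.2 hr]
  simp only [oddCoords, AddEquiv.coe_mk, Equiv.coe_fn_mk, hker]
  constructor
  · rintro ⟨⟨s, t, h1, h2⟩, m, h3⟩
    refine ⟨(s - m : ℤ) + (m : ℤ) * ξ + t * (ξ ^ 2 - 5 * ξ + 1), ?_⟩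
    have h0 : p₀ = s * v - v * m := by linarith
    rw [hr, h0, h2, h3]
    push_cast
    rw [hnR]
    linear_combination (-(m * c : AdjoinRoot cubic) - c * t * (ξ - 4)) * hF
  · rintro ⟨q, hq⟩
    obtain ⟨q₀, q₁, q₂, hq'⟩ := exists_eq_coords q
    have h : r = (v * q₀ : ℤ) + (v * q₁ : ℤ) * ξ +
        ((q₀ + q₁) * c + q₂ * n : ℤ) * (ξ ^ 2 - 5 * ξ + 1) := by
      rw [hq, hq']
      push_cast
      rw [hnR]
      linear_combination ((q₁ * c : AdjoinRoot cubic) + c * q₂ * (ξ - 4)) * hF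
    have h' := (cubicEquiv_eq_iff.2 hr).symm.trans (cubicEquiv_eq_iff.2 h)
    simp only [Prod.mk.injEq] at h'
    obtain ⟨rfl, rfl, rfl⟩ := h'
    exact ⟨⟨q₀ + q₁, q₂, by ring, rfl⟩, dvd_mul_right _ _⟩

/-- Here the rows are `(v, v, c)`, `(-v, 6v, v + c)`, `(0, 0, n)`. In `evenCoords` the first two
differ only by `v` in the last coordinate, which splits off. This leaves `(n, v + 2c)` and `(-3n,
2n)`, and `2n + 3(v + 2c) = 7v` makes the pair triangular. -/
theorem exists_hom_even {v n d : ℕ} {c : ℤ} (hv : 0 < v) (hn : 0 < n)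
    (hnv : (n : ℤ) = 2 * v - 3 * c) (hd : d = Int.gcd v c)
    (h7 : ∀ e : ℤ, e ∣ n → e ∣ 7 * v → e ∣ v) :
    ∃ φ : AdjoinRoot cubic →+ (ZMod d × ZMod (n * (7 * v) / d)) × ZMod v, Function.Surjective φ ∧
      ∀ r, φ r = 0 ↔ (v : AdjoinRoot cubic) * (1 + ξ) + c * (ξ ^ 2 - 5 * ξ + 1) ∣ r := by
  have hdv : (d : ℤ) ∣ v := hd ▸ Int.gcd_dvd_left ..
  have hdc : (d : ℤ) ∣ c := hd ▸ Int.gcd_dvd_right ..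
  have hdn : (d : ℤ) ∣ n := hnv ▸ dvd_sub (hdv.mul_left 2) (hdc.mul_left 3)
  obtain ⟨f, hf, hker⟩ := exists_smith_two (b := v + 2 * c) hn (w := 7 * v) (by omega)
    (Int.natCast_dvd_natCast.1 hdn) (dvd_add hdv (hdc.mul_left 2))
    ((Int.natCast_dvd_natCast.1 hdv).mul_left 7) (by
      intro e h1 h2 h3
      have h1' : (e : ℤ) ∣ n := by exact_mod_cast h1
      have hev : (e : ℤ) ∣ v := h7 e h1' (by exact_mod_cast h3)
      have h2c : (e : ℤ) ∣ 2 * c := (dvd_add_right hev).1 h2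
      have h3c : (e : ℤ) ∣ 3 * c := by
        rw [show 3 * c = 2 * v - n by linarith]
        exact dvd_sub (hev.mul_left 2) h1'
      have hec : (e : ℤ) ∣ c := by
        rw [show c = 3 * c - 2 * c by ring]
        exact dvd_sub h3c h2c
      rw [hd]
      exact Int.natCast_dvd_natCast.1 (Int.dvd_coe_gcd hev hec))
  obtain ⟨φ, hφ, hφk⟩ := exists_hom_prod (cubicEquiv.trans evenCoords) hf v
  have hF := root_cubic
  have hnR : (n : AdjoinRoot cubic) = 2 * v - 3 * c := by
    exact_mod_cast congrArg (Int.cast (R := AdjoinRoot cubic)) hnv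
  have key : ∀ q₀ q₁ q₂ : ℤ,
      ((v : AdjoinRoot cubic) * (1 + ξ) + c * (ξ ^ 2 - 5 * ξ + 1)) *
        (q₀ + q₁ * ξ + q₂ * (ξ ^ 2 - 5 * ξ + 1)) =
      (v * q₀ - v * q₁ : ℤ) + (v * q₀ + 6 * v * q₁ : ℤ) * ξ +
        (c * q₀ + (v + c) * q₁ + n * q₂ : ℤ) * (ξ ^ 2 - 5 * ξ + 1) := by
    intro q₀ q₁ q₂
    push_cast
    rw [hnR]
    linear_combination ((q₁ * c : AdjoinRoot cubic) + c * q₂ * (ξ - 4) + v * q₂) * hF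
  refine ⟨φ, hφ, fun r => ?_⟩
  obtain ⟨p₀, p₁, p₂, hr⟩ := exists_eq_coords r
  rw [hφk, AddEquiv.trans_apply, cubicEquiv_eq_iff.2 hr]
  simp only [evenCoords, AddEquiv.coe_mk, Equiv.coe_fn_mk, hker]
  constructor
  · rintro ⟨⟨s, t, h1, h2⟩, m, h3⟩
    -- These coefficients solve `s = q₀ + q₁ - 3q₂`, `t = q₂`, `m = 3q₀ + 4q₁`, the relations used
    -- in the converse.
    refine ⟨(4 * (s + 3 * t) - m : ℤ) + (m - 3 * (s + 3 * t) : ℤ) * ξ +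
      (t : ℤ) * (ξ ^ 2 - 5 * ξ + 1), ?_⟩
    push_cast at h2
    rw [key, hr, ← cubicEquiv_eq_iff, (cubicEquiv_eq_iff (r := _ + _)).2 rfl]
    simp only [Prod.mk.injEq]
    rw [hnv] at *
    refine ⟨?_, ?_, ?_⟩ <;> linarith
  · rintro ⟨q, hq⟩
    obtain ⟨q₀, q₁, q₂, hq'⟩ := exists_eq_coords q
    have h := hq
    rw [hq', key] at h
    have h' := (cubicEquiv_eq_iff.2 hr).symm.trans (cubicEquiv_eq_iff.2 h)
    simp only [Prod.mk.injEq] at h'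
    obtain ⟨rfl, rfl, rfl⟩ := h'
    refine ⟨⟨q₀ + q₁ - 3 * q₂, q₂, ?_, ?_⟩, 3 * q₀ + 4 * q₁, ?_⟩
    · rw [hnv]; ring
    · rw [hnv]; push_cast; ring
    · ring

/-! ### Splitting off the free summand. -/

open Polynomial in
/-- `p ↦ (p - p(1)) / (X - 1)` as an additive map. -/
noncomputable def divXSubOne : ℤ[X] →+ ℤ[X] :=
  AddMonoidHom.mk' (fun p => p /ₘ (X - C 1)) fun p q => by
    have h : ∀ r : ℤ[X], (X - C 1) * (r /ₘ (X - C 1)) = r - C (r.eval 1) := fun r => by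
      rw [← modByMonic_X_sub_C_eq_C_eval]
      exact eq_sub_of_add_eq' (modByMonic_add_div r (X - C 1))
    apply mul_left_cancel₀ (X_sub_C_ne_zero (1 : ℤ))
    rw [mul_add, h, h, h, eval_add, C_add]
    ring

open Polynomial in
theorem divXSubOne_mul_add (q : ℤ[X]) (z : ℤ) : divXSubOne ((X - 1) * q + C z) = q := by
  have := div_modByMonic_unique (f := (X - 1) * q + C z) q (C z) (monic_X_sub_C (1 : ℤ))
    ⟨by rw [C_1]; ring, degree_C_lt.trans_eq (degree_X_sub_C 1).symm⟩
  exact this.1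

open Polynomial in
theorem sub_one_mul_divXSubOne {p : ℤ[X]} (hp : p.eval 1 = 0) : (X - 1) * divXSubOne p = p := by
  have := modByMonic_add_div p (X - C 1)
  rw [modByMonic_X_sub_C_eq_C_eval, hp, C_0, zero_add, C_1] at this
  exact this

open Polynomial in
theorem exists_hom_polynomial {T : Type*} [AddCommGroup T] (n : ℕ) {φ : AdjoinRoot cubic →+ T}
    (hφ : Function.Surjective φ)
    (hker : ∀ r, φ r = 0 ↔ ∑ i ∈ Finset.range n, AdjoinRoot.root cubic ^ i ∣ r) :
    ∃ Φ : ℤ[X] →+ T × ℤ, Function.Surjective Φ ∧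
      ∀ p, Φ p = 0 ↔ ∃ q, X ^ n - 1 ∣ p - (X - 1) * cubic * q := by
  have hgeom : (X - 1 : ℤ[X]) * ∑ i ∈ Finset.range n, X ^ i = X ^ n - 1 := mul_geom_sum X n
  have hmk : ∑ i ∈ Finset.range n, AdjoinRoot.root cubic ^ i =
      AdjoinRoot.mk cubic (∑ i ∈ Finset.range n, X ^ i) := by
    simp only [map_sum, map_pow, AdjoinRoot.mk_X]
  -- `p` is recorded by `p(1)` and `(p - p(1)) / (X - 1)`. The relations are multiples of `X - 1`,
  -- so they constrain only the quotient, by `cubic` and the geometric sum.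
  refine ⟨AddMonoidHom.prod (φ.comp ((AdjoinRoot.mk cubic).toAddMonoidHom.comp divXSubOne))
    (evalRingHom 1).toAddMonoidHom, ?_, fun p => ?_⟩
  · rintro ⟨t, z⟩
    obtain ⟨r, rfl⟩ := hφ t
    obtain ⟨q, rfl⟩ := AdjoinRoot.mk_surjective r
    refine ⟨(X - 1) * q + C z, Prod.ext ?_ ?_⟩
    · exact congrArg (fun q => φ (AdjoinRoot.mk cubic q)) (divXSubOne_mul_add q z)
    · change eval 1 _ = z
      simp
  · rw [Prod.ext_iff]
    change φ (AdjoinRoot.mk cubic (divXSubOne p)) = 0 ∧ eval 1 p = 0 ↔ _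
    rw [hker, hmk]
    constructor
    · rintro ⟨⟨r, hr⟩, h0⟩
      obtain ⟨q, rfl⟩ := AdjoinRoot.mk_surjective r
      rw [← map_mul, AdjoinRoot.mk_eq_mk] at hr
      obtain ⟨b, hb⟩ := hr
      refine ⟨b, q, ?_⟩
      linear_combination -sub_one_mul_divXSubOne h0 + (X - 1) * hb + q * hgeom
    · rintro ⟨q, a, ha⟩
      have hp : p = (X - 1) * ((∑ i ∈ Finset.range n, X ^ i) * a + cubic * q) + C 0 := by
        rw [C_0]
        linear_combination ha - a * hgeom
      refine ⟨⟨AdjoinRoot.mk cubic a, ?_⟩, by rw [hp]; simp⟩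
      conv_lhs => rw [hp]
      rw [divXSubOne_mul_add, map_add, map_mul, map_mul, AdjoinRoot.mk_self, zero_mul, add_zero]

/-! ### The shift matrix and `ℤ[X]/(X^n - 1)`. -/

theorem shiftMatrix_pow_mulVec {n : ℕ} (j : ℕ) (y : Fin n → ℤ) (i : Fin n) :
    ((shiftMatrix n ^ j).mulVec y) i =
      y ⟨(i + j) % n, Nat.mod_lt _ (Fin.pos i)⟩ := by
  induction j generalizing y with
  | zero => simp [Nat.mod_eq_of_lt i.2]
  | succ j ih =>
    rw [pow_succ, ← Matrix.mulVec_mulVec, ih, Matrix.mulVec, dotProduct,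
      Finset.sum_eq_single ⟨(i + (j + 1)) % n, Nat.mod_lt _ (Fin.pos i)⟩]
    · simp [shiftMatrix, ← add_assoc]
    · intro b _ hb
      have : (b : ℕ) ≠ (i + (j + 1)) % n := fun h => hb (Fin.ext h)
      simp [shiftMatrix, ← add_assoc] at this ⊢
      exact fun h => absurd h this
    · simp

theorem shiftMatrix_pow_self (n : ℕ) : shiftMatrix n ^ n = 1 := by
  apply Matrix.mulVec_injective
  funext y i
  rw [shiftMatrix_pow_mulVec, Matrix.one_mulVec]
  congr 1
  ext
  simp [Nat.mod_eq_of_lt i.2]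

open Polynomial in
/-- The map `ℤ[X] → ℤⁿ`, `p ↦ p(T) e₀`, for the shift matrix `T`. -/
noncomputable def shiftEval (n : ℕ) [NeZero n] : ℤ[X] →+ (Fin n → ℤ) where
  toFun p := (aeval (shiftMatrix n) p).mulVec (Pi.single 0 1)
  map_zero' := by rw [map_zero, Matrix.zero_mulVec]
  map_add' p q := by rw [map_add, Matrix.add_mulVec]

open Polynomial in
theorem shiftEval_apply (n : ℕ) [NeZero n] (p : ℤ[X]) :
    shiftEval n p = (aeval (shiftMatrix n) p).mulVec (Pi.single 0 1) := rfl

open Polynomial in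
theorem shiftEval_mul (n : ℕ) [NeZero n] (p q : ℤ[X]) :
    shiftEval n (p * q) = (aeval (shiftMatrix n) p).mulVec (shiftEval n q) := by
  rw [shiftEval_apply, shiftEval_apply, map_mul, Matrix.mulVec_mulVec]

open Polynomial in
theorem shiftEval_C_mul_X_pow (n : ℕ) [NeZero n] (a : ℤ) (j : ℕ) (i : Fin n) :
    shiftEval n (C a * X ^ j) i = if (i + j) % n = 0 then a else 0 := by
  rw [shiftEval_apply]
  simp only [map_mul, map_pow, aeval_X, aeval_C]
  rw [eq_intCast, ← zsmul_eq_mul, Matrix.smul_mulVec, Pi.smul_apply, shiftMatrix_pow_mulVec,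
    Pi.single_apply]
  simp [Fin.ext_iff]

open Polynomial in
theorem shiftEval_surjective (n : ℕ) [NeZero n] : Function.Surjective (shiftEval n) := by
  intro y
  -- `T` lowers the index, so `T^(n-j) e₀ = e_j`.
  refine ⟨∑ j : Fin n, C (y j) * X ^ (n - j : ℕ), ?_⟩
  rw [map_sum]
  funext i
  rw [Finset.sum_apply, Finset.sum_eq_single i]
  · rw [shiftEval_C_mul_X_pow, if_pos]
    rw [Nat.add_sub_cancel' i.2.le, Nat.mod_self]
  · intro j _ hj
    rw [shiftEval_C_mul_X_pow, if_neg]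
    intro h
    apply hj
    obtain ⟨c, hc⟩ := Nat.dvd_of_mod_eq_zero h
    have hi := i.2
    have hj := j.2
    have hc1 : c = 1 := by
      have h1 : n * c < n * 2 := by omega
      have h2 : 0 < n * c := by omega
      have := Nat.lt_of_mul_lt_mul_left h1
      have := Nat.pos_of_mul_pos_left h2
      omega
    subst hc1
    ext
    omega
  · simp

open Polynomial in
theorem aeval_shiftMatrix_X_pow_sub_one (n : ℕ) :
    aeval (shiftMatrix n) (X ^ n - 1 : ℤ[X]) = 0 := by
  rw [map_sub, map_pow, aeval_X, shiftMatrix_pow_self, map_one, sub_self]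

open Polynomial in
theorem shiftEval_eq_zero_iff (n : ℕ) [NeZero n] (p : ℤ[X]) :
    shiftEval n p = 0 ↔ X ^ n - 1 ∣ p := by
  have hker : ∀ q, shiftEval n ((X ^ n - 1) * q) = 0 := fun q => by
    rw [shiftEval_mul, aeval_shiftMatrix_X_pow_sub_one, Matrix.zero_mulVec]
  have hn : n ≠ 0 := NeZero.ne n
  have hmon : (X ^ n - 1 : ℤ[X]).Monic := by
    simpa using monic_X_pow_sub_C (1 : ℤ) hn
  constructor
  · intro h
    rw [← modByMonic_eq_zero_iff_dvd hmon]
    rw [← modByMonic_add_div p (X ^ n - 1), map_add, hker, add_zero] at h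
    have hdeg : (p %ₘ (X ^ n - 1)).degree < n := by
      have := degree_modByMonic_lt p hmon
      rwa [← C_1, degree_X_pow_sub_C (Nat.pos_of_ne_zero hn)] at this
    set r := p %ₘ (X ^ n - 1) with hr
    ext j
    rw [coeff_zero]
    by_cases hj : j < n
    · have hsum := as_sum_range_C_mul_X_pow' (p := r) (n := n) (by
        by_cases h0 : r = 0
        · rw [h0, natDegree_zero]; omega
        · exact (natDegree_lt_iff_degree_lt h0).2 hdeg)
      -- Coefficient `j` of the remainder is the entry at index `-j` modulo `n`.
      have h1 := congrFun h ⟨(n - j) % n, Nat.mod_lt _ (Nat.pos_of_ne_zero hn)⟩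
      rw [hsum, map_sum, Finset.sum_apply, Finset.sum_eq_single j] at h1
      · rw [shiftEval_C_mul_X_pow, if_pos] at h1
        · exact h1
        · simp [Nat.sub_add_cancel hj.le]
      · intro l hl hlj
        rw [shiftEval_C_mul_X_pow, if_neg]
        rw [Finset.mem_range] at hl
        simp only [Nat.mod_add_mod]
        intro h2
        apply hlj
        obtain ⟨c, hc⟩ := Nat.dvd_of_mod_eq_zero h2
        have hc1 : c = 1 := by
          have h1 : n * c < n * 2 := by omega
          have h2 : 0 < n * c := by omega
          have := Nat.lt_of_mul_lt_mul_left h1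
          have := Nat.pos_of_mul_pos_left h2
          omega
        subst hc1
        omega
      · simp [hj]
    · exact coeff_eq_zero_of_degree_lt (hdeg.trans_le (by exact_mod_cast not_lt.1 hj))
  · rintro ⟨q, rfl⟩
    exact hker q

theorem inv_shiftMatrix (m : ℕ) : (shiftMatrix (m + 1))⁻¹ = shiftMatrix (m + 1) ^ m :=
  Matrix.inv_eq_left_inv (by rw [← pow_succ, shiftMatrix_pow_self])

open Polynomial in
theorem aeval_shiftMatrix_eq (m : ℕ) :
    ((-2 : ℤ) • (1 : Matrix (Fin (m + 1)) (Fin (m + 1)) ℤ) + matrixA (m + 1)) *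
      (1 + matrixA (m + 1)) =
    aeval (shiftMatrix (m + 1)) ((2 - X - X ^ m) * (5 - X - X ^ m) : ℤ[X]) := by
  rw [matrixA, inv_shiftMatrix]
  simp only [map_mul, map_sub, map_pow, aeval_X, map_ofNat]
  congr 1
  · rw [show (2 : Matrix (Fin (m + 1)) (Fin (m + 1)) ℤ) = (2 : ℤ) • 1 by simp]
    module
  · rw [show (5 : Matrix (Fin (m + 1)) (Fin (m + 1)) ℤ) = (5 : ℤ) • 1 by simp]
    module

open Polynomial in
/-- The composite of `p ↦ p(T) e₀` with the projection to the cokernel. -/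
noncomputable def cokerHom (n : ℕ) [NeZero n] (M : Matrix (Fin n) (Fin n) ℤ) : ℤ[X] →+ coker M :=
  (LinearMap.range M.mulVecLin).mkQ.toAddMonoidHom.comp (shiftEval n)

theorem cokerHom_surjective (n : ℕ) [NeZero n] (M : Matrix (Fin n) (Fin n) ℤ) :
    Function.Surjective (cokerHom n M) :=
  (Submodule.mkQ_surjective _).comp (shiftEval_surjective n)

open Polynomial in
theorem cokerHom_aeval_eq_zero_iff (n : ℕ) [NeZero n] (f p : ℤ[X]) :
    cokerHom n (aeval (shiftMatrix n) f) p = 0 ↔ ∃ q, X ^ n - 1 ∣ p - f * q := by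
  change Submodule.Quotient.mk (shiftEval n p) = 0 ↔ _
  rw [Submodule.Quotient.mk_eq_zero, LinearMap.mem_range, (shiftEval_surjective n).exists]
  refine exists_congr fun q => ?_
  rw [Matrix.mulVecLin_apply, ← shiftEval_mul, ← shiftEval_eq_zero_iff, map_sub, sub_eq_zero,
    eq_comm]

-- Modulo `X^(m+1) - 1` one has `X^m = X⁻¹`, so the two generators differ by the unit `X²`, whose
-- inverse is `X^(2m)`.
open Polynomial in
theorem exists_dvd_sub_iff (m : ℕ) (p : ℤ[X]) :
    (∃ q, X ^ (m + 1) - 1 ∣ p - (2 - X - X ^ m) * (5 - X - X ^ m) * q) ↔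
      ∃ q, X ^ (m + 1) - 1 ∣ p - (X - 1) * cubic * q := by
  have h1 : (X ^ (m + 1) - 1 : ℤ[X]) ∣
      (X - 1) * cubic - (2 - X - X ^ m) * (5 - X - X ^ m) * X ^ 2 := by
    refine ⟨7 * X - 2 * X ^ 2 - X ^ (m + 1) - 1, ?_⟩
    rw [cubic]
    ring
  have h2 : (X ^ (m + 1) - 1 : ℤ[X]) ∣ X ^ (2 * (m + 1)) - 1 := by
    rw [mul_comm, pow_mul]
    simpa using sub_dvd_pow_sub_pow (X ^ (m + 1) : ℤ[X]) 1 2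
  constructor
  · rintro ⟨q, hq⟩
    refine ⟨X ^ (2 * m) * q, ?_⟩
    have := (hq.sub (h1.mul_right (X ^ (2 * m) * q))).sub
      (h2.mul_right ((2 - X - X ^ m) * (5 - X - X ^ m) * q))
    convert this using 1
    ring
  · rintro ⟨q, hq⟩
    refine ⟨X ^ 2 * q, ?_⟩
    convert hq.add (h1.mul_right q) using 1
    ring

/-! ### Assembling the isomorphism. -/

theorem nonempty_addEquiv_of_ker {G A B : Type*} [AddCommGroup G] [AddCommGroup A]
    [AddCommGroup B] {f : G →+ A} {g : G →+ B} (hf : Function.Surjective f)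
    (hg : Function.Surjective g) (h : ∀ p, f p = 0 ↔ g p = 0) : Nonempty (A ≃+ B) := by
  have hk : f.ker = g.ker := AddSubgroup.ext h
  exact ⟨(QuotientAddGroup.quotientKerEquivOfSurjective f hf).symm.trans
    ((QuotientAddGroup.quotientAddEquivOfEq hk).trans
      (QuotientAddGroup.quotientKerEquivOfSurjective g hg))⟩

/-- Reordering of a product of four additive groups. -/
def prodReorder (A B C D : Type*) [AddCommGroup A] [AddCommGroup B] [AddCommGroup C]
    [AddCommGroup D] : ((A × B) × C) × D ≃+ A × C × B × D where
  toFun y := (y.1.1.1, y.1.2, y.1.1.2, y.2)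
  invFun z := (((z.1, z.2.2.1), z.2.1), z.2.2.2)
  left_inv _ := rfl
  right_inv _ := rfl
  map_add' _ _ := rfl

theorem nonempty_coker_addEquiv {n : ℕ} (hn : 1 ≤ n) {A B C : Type} [AddCommGroup A]
    [AddCommGroup B] [AddCommGroup C] {φ : AdjoinRoot cubic →+ (A × B) × C}
    (hφ : Function.Surjective φ)
    (hker : ∀ r, φ r = 0 ↔ ∑ i ∈ Finset.range n, AdjoinRoot.root cubic ^ i ∣ r) :
    Nonempty (coker (((-2 : ℤ) • (1 : Matrix (Fin n) (Fin n) ℤ) + matrixA n) * (1 + matrixA n)) ≃+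
      A × C × B × ℤ) := by
  obtain ⟨m, rfl⟩ := Nat.exists_eq_add_one.2 hn
  obtain ⟨Φ, hΦ, hΦk⟩ := exists_hom_polynomial (m + 1) hφ hker
  rw [aeval_shiftMatrix_eq]
  obtain ⟨e⟩ := nonempty_addEquiv_of_ker (cokerHom_surjective (m + 1) _) hΦ fun p => by
    rw [cokerHom_aeval_eq_zero_iff, exists_dvd_sub_iff, hΦk]
  exact ⟨e.trans (prodReorder A B C ℤ)⟩

theorem exists_odd_case (k : ℕ) : ∃ v : ℕ, (v : ℤ) = chebSeq (k + 1) + chebSeq k ∧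
    ∃ d : ℕ, d * Nat.gcd (2 * k + 1) 3 = Nat.gcd (2 * k + 1) v ∧
      ∃ φ : AdjoinRoot cubic →+ (ZMod d × ZMod (v * (2 * k + 1) / d)) × ZMod v,
        Function.Surjective φ ∧
        ∀ r, φ r = 0 ↔ ∑ i ∈ Finset.range (2 * k + 1), AdjoinRoot.root cubic ^ i ∣ r := by
  obtain ⟨v, hv⟩ := Int.eq_ofNat_of_zero_le
    (add_nonneg (chebSeq_nonneg (k + 1)) (chebSeq_nonneg k))
  have hpos := add_pos_of_pos_of_nonneg (chebSeq_pos k.succ_pos) (chebSeq_nonneg k)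
  obtain ⟨c, hc, hass⟩ := exists_associated_odd k
  rw [hv] at hc hass hpos
  refine ⟨v, hv.symm, Int.gcd v c, ?_, ?_⟩
  · have key := gcd_mul_gcd_three (P := Odd)
      (f := fun j => chebSeq (j / 2 + 1) + chebSeq (j / 2)) (l := 1) rfl
      (fun j hj => (by decide : Odd 3).mul hj) (fun j i h => (Nat.odd_mul.1 h).2)
      (by
        rintro _ ⟨j, rfl⟩
        rw [show (2 * j + 1) / 2 = j by omega]
        have h := chebSeq_modEq_three j
        have := h.2.add h.1
        refine this.trans (by rw [show (((2 * j + 1 : ℕ) : ℤ)) = j + 1 + j by push_cast; ring]))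
      (by
        rintro _ ⟨j, rfl⟩
        rw [show (2 * j + 1) / 2 = j by omega, show 3 * (2 * j + 1) / 2 = 3 * j + 1 by omega,
          chebSeq_odd_three_mul, one_mul])
      (Nat.succ_pos (2 * k)) (odd_two_mul_add_one k) (ε := 1) (by norm_num) (c := c)
      (by
        rw [show (2 * k).succ / 2 = k by omega, hv, Nat.succ_eq_add_one, hc]; push_cast; ring)
    simp only [show (2 * k).succ / 2 = k by omega, hv, Nat.cast_one, one_mul] at key
    exact_mod_cast key
  · obtain ⟨φ, hφ, hk⟩ := exists_hom_odd (by exact_mod_cast hpos) (Nat.succ_pos (2 * k)) hc rfl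
    refine ⟨φ, hφ, fun r => ?_⟩
    rw [hk, hass.dvd_iff_dvd_left, Int.cast_natCast]

theorem exists_even_case {k : ℕ} (hk : 0 < k) : ∃ v : ℕ, (v : ℤ) = chebSeq k ∧
    ∃ d : ℕ, d * Nat.gcd (2 * k) 3 = Nat.gcd (2 * k) v ∧
      ∃ φ : AdjoinRoot cubic →+ (ZMod d × ZMod (2 * k * (7 * v) / d)) × ZMod v,
        Function.Surjective φ ∧
        ∀ r, φ r = 0 ↔ ∑ i ∈ Finset.range (2 * k), AdjoinRoot.root cubic ^ i ∣ r := by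
  obtain ⟨v, hv⟩ := Int.eq_ofNat_of_zero_le (chebSeq_nonneg k)
  have hpos := chebSeq_pos hk
  obtain ⟨c, hc, hass⟩ := exists_associated_even k
  have h7 := fun d => dvd_chebSeq_of_dvd (d := d) hk
  rw [hv] at hc hass hpos h7
  refine ⟨v, hv.symm, Int.gcd v c, ?_, ?_⟩
  · have key := gcd_mul_gcd_three (P := fun _ => True) (f := chebSeq) (l := 7) rfl
      (fun _ _ => trivial) (fun _ _ _ => trivial) (fun j _ => (chebSeq_modEq_three j).1)
      (fun j _ => chebSeq_three_mul j) hk trivial (ε := 2) (by norm_num) (c := c)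
      (by rw [hv]; push_cast at hc ⊢; linarith)
    rw [hv] at key
    exact_mod_cast key
  · obtain ⟨φ, hφ, hk⟩ := exists_hom_even (by exact_mod_cast hpos) (by omega) hc rfl
      (by exact_mod_cast h7)
    refine ⟨φ, hφ, fun r => ?_⟩
    rw [hk, hass.dvd_iff_dvd_left, Int.cast_natCast]

theorem proposition3 (n : ℕ) (hn : 1 ≤ n) :
    ∃ v : ℕ, (v : ℂ) = nu n ∧ Nat.gcd n 3 ∣ Nat.gcd n v ∧ Nat.gcd n v ∣ n * muHat n * v ∧
      Nonempty
        (coker (((-2 : ℤ) • (1 : Matrix (Fin n) (Fin n) ℤ) + matrixA n) * (1 + matrixA n)) ≃+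
          ZMod (Nat.gcd n v / Nat.gcd n 3) × ZMod v ×
            ZMod (n * muHat n * v / Nat.gcd n v) × ℤ) := by
  have hg : 0 < Nat.gcd n 3 := Nat.gcd_pos_of_pos_right _ (by norm_num)
  have hdvd : ∀ v, Nat.gcd n v ∣ n * muHat n * v := fun v => (Nat.gcd_dvd_right n v).mul_left _
  rcases Nat.even_or_odd' n with ⟨k, rfl | rfl⟩
  · obtain ⟨v, hv, d, hd, φ, hφ, hk⟩ := exists_even_case (k := k) (by omega)
    refine ⟨v, by rw [nu_even, ← hv, Int.cast_natCast], ⟨d, by rw [← hd, mul_comm]⟩, hdvd v, ?_⟩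
    have h1 : Nat.gcd (2 * k) v / Nat.gcd (2 * k) 3 = d := by
      rw [← hd, Nat.mul_div_cancel _ hg]
    -- The factor `gcd(n, 3)` in `μ̂` cancels the one in `gcd(n, v) = d * gcd(n, 3)`.
    have h2 : 2 * k * muHat (2 * k) * v / Nat.gcd (2 * k) v = 2 * k * (7 * v) / d := by
      rw [← hd, muHat, mu, if_neg (by simp), ← Nat.mul_div_mul_right (2 * k * (7 * v)) d hg]
      congr 1
      ring
    rw [h1, h2]
    exact nonempty_coker_addEquiv hn hφ hk
  · obtain ⟨v, hv, d, hd, φ, hφ, hk⟩ := exists_odd_case k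
    refine ⟨v, ?_, ⟨d, by rw [← hd, mul_comm]⟩, hdvd v, ?_⟩
    · rw [nu_odd]
      exact_mod_cast congrArg (Int.cast (R := ℂ)) hv
    have h1 : Nat.gcd (2 * k + 1) v / Nat.gcd (2 * k + 1) 3 = d := by
      rw [← hd, Nat.mul_div_cancel _ hg]
    have h2 : (2 * k + 1) * muHat (2 * k + 1) * v / Nat.gcd (2 * k + 1) v =
        v * (2 * k + 1) / d := by
      rw [← hd, muHat, mu, if_pos (by simp), ← Nat.mul_div_mul_right (v * (2 * k + 1)) d hg]
      congr 1
      ring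
    rw [h1, h2]
    exact nonempty_coker_addEquiv hn hφ hk
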